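/- Let $r\ge 1$, let $P_1,\dots,P_r$ be $d$-dimensional polytopes in a finite-dimensional real vector space, and let $P=P_1+\cdots+P_r$ be their Minkowski sum. The faces of a polytope are the empty face (of dimension $-1$) and the sets of maximizers over it of linear functionals; in particular, the polytope is a face of itself. Write $f_k(F)$ for the number of $k$-dimensional faces of a polytope $F$. Every nonempty face $F$ of $P$ has a unique decomposition $F=F_1+\cdots+F_r$ with $F_i$ a face of $P_i$; for $F=\emptyset$ put $F_i=\emptyset$. Define $$f^\delta_k(F)=f_k(F)-\bigl(f_k(F_1)+\cdots+f_k(F_r)\bigr).$$ Then, for every integer $k<d$, $$\sum_{F\subseteq P}(-1)^{d-\dim F}f^\delta_k(F)=0,$$ where $F$ runs over all faces of $P$. Equivalently, if $\dim P=d$ (which holds automatically when the ambient space has dimension $d$), $$f^\delta_k(P)=-\sum_{F\subsetneq P}(-1)^{d-\dim F}f^\delta_k(F),$$ where $F$ runs over all proper faces of $P$, including the empty face. -/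

import Mathlib

open scoped Pointwise

namespace MinkowskiFaces

variable {E : Type*} [NormedAddCommGroup E] [NormedSpace ℝ E]

/-- A polytope: the convex hull of finitely many points. -/
def IsPolytope (P : Set E) : Prop :=
  ∃ S : Set E, S.Finite ∧ P = convexHull ℝ S

/-- The set of all faces of `P`: the empty face, and the sets of maximizers over `P` of linear
functionals (the zero functional gives `P` itself). -/
def faces (P : Set E) : Set (Set E) :=
  {F | IsExposed ℝ P F}

/-- The dimension of a set: the dimension of its affine hull, with `dim ∅ = -1`. -/
noncomputable def dim (F : Set E) : ℤ :=
  open Classical in if F = ∅ then -1 else (Module.finrank ℝ (vectorSpan ℝ F) : ℤ)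

/-- The entry `f_k(F)` of the f-vector: the number of `k`-dimensional faces of `F`. -/
noncomputable def fVec (k : ℤ) (F : Set E) : ℕ :=
  {G ∈ faces F | dim G = k}.ncard

/-- The `i`-th part `F_i` of a face `F` of `P_1 + ⋯ + P_r`: the `i`-th components of
the tuples in `P_1 × ⋯ × P_r` whose sum lies in `F`. For a nonempty face this is the unique
decomposition of `F` into faces of the summands, see `isDecomposition_iff`. The parts of the empty
face are empty. -/
def part {r : ℕ} (P : Fin r → Set E) (F : Set E) (i : Fin r) : Set E :=
  {x | ∃ z : Fin r → E, (∀ j, z j ∈ P j) ∧ ∑ j, z j ∈ F ∧ z i = x}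

/-- `G_1, …, G_r` are faces of `P_1, …, P_r` whose sum is `F`. -/
def IsDecomposition {r : ℕ} (P : Fin r → Set E) (F : Set E) (G : Fin r → Set E) : Prop :=
  (∀ i, G i ∈ faces (P i)) ∧ ∑ i, G i = F

/-- The entry `f^δ_k(F) = f_k(F) - (f_k(F_1) + ⋯ + f_k(F_r))` of the `f^δ`-vector of a face `F` of
`P_1 + ⋯ + P_r`. -/
noncomputable def fDelta {r : ℕ} (P : Fin r → Set E) (k : ℤ) (F : Set E) : ℤ :=
  (fVec k F : ℤ) - ∑ i, (fVec k (part P F i) : ℤ)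

/-! Facts showing that the notions above are well defined. -/

theorem mem_sum_iff {V : Type*} [AddCommMonoid V] {r : ℕ} {P : Fin r → Set V} {x : V} :
    x ∈ ∑ i, P i ↔ ∃ z : Fin r → V, (∀ i, z i ∈ P i) ∧ ∑ i, z i = x := by
  simp [Set.mem_fintype_sum]

theorem IsPolytope.isCompact {P : Set E} (hP : IsPolytope P) : IsCompact P := by
  obtain ⟨S, hS, rfl⟩ := hP
  exact hS.isCompact_convexHull (𝕜 := ℝ)

theorem IsPolytope.convex {P : Set E} (hP : IsPolytope P) : Convex ℝ P := by
  obtain ⟨S, hS, rfl⟩ := hP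
  exact convex_convexHull ℝ S

theorem IsPolytope.sum {r : ℕ} {P : Fin r → Set E} (hP : ∀ i, IsPolytope (P i)) :
    IsPolytope (∑ i, P i) := by
  choose S hS hPS using hP
  refine ⟨∑ i, S i, ?_, ?_⟩
  · exact Finset.sum_induction S Set.Finite (fun _ _ h1 h2 => h1.add h2)
      (Set.finite_zero) (fun i _ => hS i)
  · rw [convexHull_sum]
    exact Finset.sum_congr rfl fun i _ => hPS i

theorem face_eq_convexHull {S F : Set E} (hS : S.Finite) (hF : F ∈ faces (convexHull ℝ S)) :
    F = convexHull ℝ (S ∩ F) := by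
  have hF' : IsExposed ℝ (convexHull ℝ S) F := hF
  have hc : Convex ℝ F := hF'.convex (convex_convexHull ℝ S)
  apply Set.Subset.antisymm
  · have hk : IsCompact F := hF'.isCompact (hS.isCompact_convexHull (𝕜 := ℝ))
    refine (closure_convexHull_extremePoints hk hc).symm.subset.trans ?_
    apply closure_minimal
    · apply convexHull_mono
      intro x (hx : x ∈ F.extremePoints ℝ)
      refine ⟨?_, hx.1⟩
      exact extremePoints_convexHull_subset (hF'.isExtreme.extremePoints_subset_extremePoints hx)
    · exact ((hS.inter_of_left F).isCompact_convexHull (𝕜 := ℝ)).isClosed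
  · exact convexHull_min Set.inter_subset_right hc

/-- A polytope has finitely many faces. -/
theorem IsPolytope.finite_faces {P : Set E} (hP : IsPolytope P) : (faces P).Finite := by
  obtain ⟨S, hS, rfl⟩ := hP
  refine (hS.finite_subsets.image fun T => convexHull ℝ T).subset ?_
  intro F hF
  exact ⟨S ∩ F, Set.inter_subset_left, (face_eq_convexHull hS hF).symm⟩

/-- The faces of a polytope are polytopes. -/
theorem IsPolytope.face {P F : Set E} (hP : IsPolytope P) (hF : F ∈ faces P) : IsPolytope F := by
  obtain ⟨S, hS, rfl⟩ := hP
  exact ⟨S ∩ F, hS.inter_of_left F, face_eq_convexHull hS hF⟩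

theorem part_eq {r : ℕ} {P : Fin r → Set E} {F : Set E} (hne : F.Nonempty) (l : StrongDual ℝ E)
    (hl : F = {x ∈ ∑ i, P i | ∀ y ∈ ∑ i, P i, l y ≤ l x}) (i : Fin r) :
    part P F i = {x ∈ P i | ∀ y ∈ P i, l y ≤ l x} := by
  have key : ∀ (z : Fin r → E) (y : E), ∑ j, Function.update z i y j = ∑ j, z j - z i + y := by
    intro z y
    rw [Finset.sum_update_of_mem (Finset.mem_univ i), ← Finset.add_sum_erase _ z (Finset.mem_univ i),
      Finset.sdiff_singleton_eq_erase]
    abel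
  have upd : ∀ (z : Fin r → E) (y : E), (∀ j, z j ∈ P j) → y ∈ P i →
      ∀ j, Function.update z i y j ∈ P j := by
    intro z y hz hy j
    rcases eq_or_ne j i with rfl | h
    · simpa using hy
    · simpa [h] using hz j
  ext x
  constructor
  · rintro ⟨z, hz, hzF, rfl⟩
    refine ⟨hz i, fun y hy => ?_⟩
    rw [hl] at hzF
    have := hzF.2 _ (mem_sum_iff.2 ⟨_, upd z y hz hy, rfl⟩)
    rw [key] at this
    simp only [map_add, map_sub] at this
    linarith
  · rintro ⟨hx, hmax⟩
    obtain ⟨p, hp⟩ := hne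
    have hp' := hp
    rw [hl] at hp'
    obtain ⟨z, hz, rfl⟩ := mem_sum_iff.1 hp'.1
    refine ⟨Function.update z i x, upd z x hz hx, ?_, by simp⟩
    rw [hl]
    refine ⟨mem_sum_iff.2 ⟨_, upd z x hz hx, rfl⟩, fun y hy => (hp'.2 y hy).trans ?_⟩
    rw [key]
    simp only [map_add, map_sub]
    linarith [hmax _ (hz i)]

/-- Every nonempty face of a Minkowski sum of polytopes has exactly one decomposition into faces of
the summands, and `part` gives it. -/
theorem isDecomposition_iff {r : ℕ} {P : Fin r → Set E} (hP : ∀ i, IsPolytope (P i))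
    {F : Set E} (hF : F ∈ faces (∑ i, P i)) (hne : F.Nonempty) (G : Fin r → Set E) :
    IsDecomposition P F G ↔ G = part P F := by
  obtain ⟨l, hl⟩ := hF hne
  have hmem : ∀ z : Fin r → E, (∀ j, z j ∈ part P F j) → ∑ j, z j ∈ F := by
    intro z hz
    have hz' : ∀ j, z j ∈ {x ∈ P j | ∀ y ∈ P j, l y ≤ l x} := fun j => part_eq hne l hl j ▸ hz j
    rw [hl]
    refine ⟨mem_sum_iff.2 ⟨z, fun j => (hz' j).1, rfl⟩, fun y hy => ?_⟩
    obtain ⟨w, hw, rfl⟩ := mem_sum_iff.1 hy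
    rw [map_sum, map_sum]
    exact Finset.sum_le_sum fun j _ => (hz' j).2 _ (hw j)
  have hface : ∀ i, part P F i ∈ faces (P i) := fun i _ => ⟨l, part_eq hne l hl i⟩
  constructor
  · rintro ⟨hG, hsum⟩
    have hGP : ∀ i, G i ⊆ P i := fun i => IsExposed.subset (hG i)
    have hGne : ∀ i, (G i).Nonempty := by
      obtain ⟨p, hp⟩ := hne
      rw [← hsum] at hp
      obtain ⟨z, hz, -⟩ := mem_sum_iff.1 hp
      exact fun i => ⟨z i, hz i⟩
    have hsub : ∀ i, G i ⊆ part P F i := by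
      intro i x hx
      choose z hz using hGne
      have hu : ∀ j, Function.update z i x j ∈ G j := by
        intro j
        rcases eq_or_ne j i with rfl | h
        · simpa using hx
        · simpa [h] using hz j
      refine ⟨Function.update z i x, fun j => hGP j (hu j), ?_, by simp⟩
      rw [← hsum]
      exact mem_sum_iff.2 ⟨_, hu, rfl⟩
    funext i
    refine (hsub i).antisymm fun x hx => ?_
    by_contra hxG
    have hcomp : ∀ j, IsCompact (G j) := fun j => ((hP j).face (hG j)).isCompact
    obtain ⟨m, u, hmG, hmx⟩ := geometric_hahn_banach_closed_point
      ((hP i).face (hG i)).convex (hcomp i).isClosed hxG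
    choose z hz hzmax using fun j => (hcomp j).exists_isMaxOn (hGne j) m.continuous.continuousOn
    have hu : ∀ j, Function.update z i x j ∈ part P F j := by
      intro j
      rcases eq_or_ne j i with rfl | h
      · simpa using hx
      · simpa [h] using hsub j (hz j)
    have hs := hmem _ hu
    rw [← hsum] at hs
    obtain ⟨g, hg, hgs⟩ := mem_sum_iff.1 hs
    have hlt : ∑ j, m (g j) < ∑ j, m (Function.update z i x j) := by
      apply Finset.sum_lt_sum
      · intro j _
        rcases eq_or_ne j i with rfl | h
        · simpa using ((hmG _ (hg j)).trans hmx).le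
        · simpa [h] using hzmax j (hg j)
      · exact ⟨i, Finset.mem_univ i, by simpa using (hmG _ (hg i)).trans hmx⟩
    rw [← map_sum, ← map_sum, hgs] at hlt
    exact lt_irrefl _ hlt
  · rintro rfl
    refine ⟨hface, Set.Subset.antisymm ?_ ?_⟩
    · intro x hx
      obtain ⟨z, hz, rfl⟩ := mem_sum_iff.1 hx
      exact hmem z hz
    · intro x hx
      have hx' := hx
      rw [hl] at hx'
      obtain ⟨z, hz, rfl⟩ := mem_sum_iff.1 hx'.1
      exact mem_sum_iff.2 ⟨z, fun j => ⟨z, hz, hx, rfl⟩, rfl⟩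

/-- A Minkowski sum of at least one full-dimensional polytopes is full-dimensional. -/
theorem dim_sum_eq [FiniteDimensional ℝ E] {r : ℕ} (hr : 0 < r) {P : Fin r → Set E}
    (hd : ∀ i, dim (P i) = Module.finrank ℝ E) : dim (∑ i, P i) = Module.finrank ℝ E := by
  have hne : ∀ i, (P i).Nonempty := by
    intro i
    by_contra h
    have := hd i
    rw [Set.not_nonempty_iff_eq_empty.1 h] at this
    simp only [dim, if_true] at this
    omega
  choose z hz using hne
  have hsum : (∑ i, P i).Nonempty := ⟨_, mem_sum_iff.2 ⟨z, hz, rfl⟩⟩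
  let i : Fin r := ⟨0, hr⟩
  have h0 := hd i
  simp only [dim, (Set.nonempty_iff_ne_empty.1 ⟨z i, hz i⟩), hsum.ne_empty, if_false,
    Nat.cast_inj] at h0 ⊢
  refine le_antisymm (Submodule.finrank_le _) (h0.symm.le.trans (Submodule.finrank_mono ?_))
  rw [vectorSpan_def, Submodule.span_le]
  rintro _ ⟨x, hx, y, hy, rfl⟩
  have upd : ∀ w ∈ P i, ∑ j, Function.update z i w j ∈ ∑ j, P j := by
    intro w hw
    refine mem_sum_iff.2 ⟨_, fun j => ?_, rfl⟩
    rcases eq_or_ne j i with rfl | h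
    · simpa using hw
    · simpa [h] using hz j
  have := vsub_mem_vectorSpan ℝ (upd x hx) (upd y hy)
  rw [Finset.sum_update_of_mem (Finset.mem_univ i), Finset.sum_update_of_mem (Finset.mem_univ i)]
    at this
  simpa using this

end MinkowskiFaces

/-! By linearity it suffices that the sum over the faces F of P of (-1)^(dim F) f_k(p(F)) vanishes
in two cases: p = id with Q = P, and p(F) = F_i with Q = P_i. In both, p sends the face of P exposed
by a functional to the face of Q exposed by the same functional, so the normal fan of P refines that
of Q. Counting pairs G ⊆ p(F), with G a k-face of Q, reduces this to
`IsPolytope.sum_faceSign_filter`: for a face G ≠ Q, the signs (-1)^(dim F) over all F with G ⊆ p(F)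
add up to 0. The case G = Q never arises, because k < d ≤ dim Q.

This is an Euler characteristic computation in the dual space. For F nonempty, (-1)^(dim F) is, up
to a global sign, the compactly supported Euler characteristic of the open normal cone of F. Let G
be nonempty and W the linear hull of its normal cone in Q. The cones with p(F) = G partition the
open normal cone of G and contribute (-1)^(dim W). Those with p(F) strictly larger than G form its
relative boundary. Fix m exposing G: every line in W parallel to m meets this boundary exactly once,
so adding ℝm to each of these cones raises its dimension by one and yields a partition of W. Hence
they contribute -(-1)^(dim W) (`IsPolytope.sum_openEuler_boundary`), and the total is 0. For G = ∅
the claim is Euler's relation, which holds because the open normal cones partition the dual space.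

The Euler characteristic is additive (`IsRelOpen.openEuler_eq_sum`) because a single hyperplane cut
preserves it and the partitions in question are resolved by finitely many hyperplanes. -/

namespace MinkowskiFaces

/-! ### Relatively open convex sets and their Euler characteristic -/

section RelOpen

variable {V : Type*} [AddCommGroup V] [Module ℝ V]

/-- A convex set that is open in its affine hull, expressed without a topology. -/
def IsRelOpen (C : Set V) : Prop :=
  Convex ℝ C ∧ ∀ x ∈ C, ∀ y ∈ C, ∃ ε : ℝ, 0 < ε ∧ x + ε • (x - y) ∈ C

theorem IsRelOpen.exists_add_smul_mem {C : Set V} (hC : IsRelOpen C) {x : V} (hx : x ∈ C) {v : V}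
    (hv : v ∈ vectorSpan ℝ C) : ∃ ε : ℝ, 0 < ε ∧ x + ε • v ∈ C := by
  have hneg : ∀ v : V, (∃ ε : ℝ, 0 < ε ∧ x + ε • v ∈ C) → ∃ ε : ℝ, 0 < ε ∧ x + ε • (-v) ∈ C := by
    rintro v ⟨ε, hε, hm⟩
    obtain ⟨δ, hδ, h⟩ := hC.2 x hx _ hm
    refine ⟨δ * ε, mul_pos hδ hε, ?_⟩
    convert h using 1
    module
  rw [vectorSpan_eq_span_vsub_set_right ℝ hx] at hv
  induction hv using Submodule.span_induction with
  | mem v hv =>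
    obtain ⟨y, hy, rfl⟩ := hv
    exact ⟨1, one_pos, by simpa using hy⟩
  | zero => exact ⟨1, one_pos, by simpa using hx⟩
  | add v w _ _ hv hw =>
    obtain ⟨ε, hε, h1⟩ := hv
    obtain ⟨δ, hδ, h2⟩ := hw
    -- The average of x + εv and x + δw with weights proportional to δ and ε moves x along v + w.
    refine ⟨ε * δ / (ε + δ), by positivity, ?_⟩
    have := hC.1 h1 h2 (show 0 ≤ δ / (ε + δ) by positivity)
      (show 0 ≤ ε / (ε + δ) by positivity) (by field_simp; ring)
    convert this using 1
    match_scalars <;> field_simp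
    ring
  | smul c v _ hv =>
    rcases lt_trichotomy c 0 with hc | rfl | hc
    · obtain ⟨ε, hε, h⟩ := hneg v hv
      refine ⟨ε / (-c), div_pos hε (neg_pos.2 hc), ?_⟩
      convert h using 2
      rw [smul_smul, smul_neg, ← neg_smul]
      congr 1
      have := hc.ne
      field_simp
    · exact ⟨1, one_pos, by simpa using hx⟩
    · obtain ⟨ε, hε, h⟩ := hv
      refine ⟨ε / c, div_pos hε hc, ?_⟩
      convert h using 2
      rw [smul_smul]
      congr 1
      field_simp

theorem IsRelOpen.inter_pos {C : Set V} (hC : IsRelOpen C) (a : Module.Dual ℝ V) :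
    IsRelOpen (C ∩ {v | 0 < a v}) := by
  refine ⟨hC.1.inter ((convex_Ioi (0 : ℝ)).linear_preimage a), ?_⟩
  rintro x ⟨hx, hax : 0 < a x⟩ y ⟨hy, hay : 0 < a y⟩
  obtain ⟨ε, hε, h⟩ := hC.2 x hx y hy
  -- The bound t ≤ a x / a y keeps (1 + t) a x - t a y positive.
  have ht : 0 < min ε (a x / a y) := lt_min hε (div_pos hax hay)
  refine ⟨min ε (a x / a y), ht, ?_, ?_⟩
  · have := hC.1.add_smul_mem hx h (t := min ε (a x / a y) / ε)
      ⟨by positivity, (div_le_one hε).2 (min_le_left _ _)⟩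
    rwa [smul_smul, div_mul_cancel₀ _ hε.ne'] at this
  · have h2 : min ε (a x / a y) * a y ≤ a x := by
      rw [← le_div_iff₀ hay]
      exact min_le_right _ _
    have h3 := mul_pos ht hax
    simp only [Set.mem_ofPred_eq, map_add, map_smul, map_sub, smul_eq_mul]
    linarith

theorem IsRelOpen.inter_neg {C : Set V} (hC : IsRelOpen C) (a : Module.Dual ℝ V) :
    IsRelOpen (C ∩ {v | a v < 0}) := by
  simpa using hC.inter_pos (-a)

theorem IsRelOpen.inter_zero {C : Set V} (hC : IsRelOpen C) (a : Module.Dual ℝ V) :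
    IsRelOpen (C ∩ {v | a v = 0}) := by
  refine ⟨hC.1.inter ((convex_singleton (0 : ℝ)).linear_preimage a), ?_⟩
  rintro x ⟨hx, hax : a x = 0⟩ y ⟨hy, hay : a y = 0⟩
  obtain ⟨ε, hε, h⟩ := hC.2 x hx y hy
  exact ⟨ε, hε, h, by simp [hax, hay]⟩

/-- A short initial piece of the segment from x to any y in C stays in the open half-space and
already spans the direction y - x. -/
theorem vectorSpan_inter_pos {C : Set V} (hC : Convex ℝ C) (a : Module.Dual ℝ V) {x : V}
    (hx : x ∈ C) (hax : 0 < a x) : vectorSpan ℝ (C ∩ {v | 0 < a v}) = vectorSpan ℝ C := by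
  refine le_antisymm (vectorSpan_mono ℝ Set.inter_subset_left) ?_
  rw [vectorSpan_eq_span_vsub_set_right ℝ hx, Submodule.span_le]
  rintro _ ⟨y, hy, rfl⟩
  obtain ⟨t, ht0, ht1, ht⟩ : ∃ t : ℝ, 0 < t ∧ t ≤ 1 ∧ 0 < a x + t * (a y - a x) := by
    refine ⟨a x / (a x + |a y - a x|), by positivity,
      (div_le_one (by positivity)).2 (by linarith [abs_nonneg (a y - a x)]), ?_⟩
    have h1 := neg_abs_le (a y - a x)
    have h0 := abs_nonneg (a y - a x)
    have h2 : a x + a x / (a x + |a y - a x|) * (a y - a x)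
        = a x * (a x + |a y - a x| + (a y - a x)) / (a x + |a y - a x|) := by
      field_simp
    rw [h2]
    have : 0 < a x + |a y - a x| + (a y - a x) := by linarith
    positivity
  have hm : x + t • (y - x) ∈ C ∩ {v | 0 < a v} :=
    ⟨hC.add_smul_mem hx (by simpa using hy) ⟨ht0.le, ht1⟩, by simpa using ht⟩
  have := (vectorSpan ℝ (C ∩ {v | 0 < a v})).smul_mem t⁻¹
    (vsub_mem_vectorSpan ℝ hm (show x ∈ C ∩ {v | 0 < a v} from ⟨hx, hax⟩))
  simpa [smul_smul, inv_mul_cancel₀ ht0.ne'] using this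

theorem vectorSpan_inter_neg {C : Set V} (hC : Convex ℝ C) (a : Module.Dual ℝ V) {x : V}
    (hx : x ∈ C) (hax : a x < 0) : vectorSpan ℝ (C ∩ {v | a v < 0}) = vectorSpan ℝ C := by
  simpa using vectorSpan_inter_pos hC (-a) hx (by simpa using hax)

theorem IsRelOpen.vectorSpan_inter_zero {C : Set V} (hC : IsRelOpen C) (a : Module.Dual ℝ V) {x : V}
    (hx : x ∈ C) (hax : a x = 0) :
    vectorSpan ℝ (C ∩ {v | a v = 0}) = vectorSpan ℝ C ⊓ LinearMap.ker a := by
  refine le_antisymm (le_inf (vectorSpan_mono ℝ Set.inter_subset_left) ?_) ?_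
  · rw [vectorSpan_def, Submodule.span_le]
    rintro _ ⟨y, ⟨-, hy : a y = 0⟩, z, ⟨-, hz : a z = 0⟩, rfl⟩
    simp [hy, hz]
  · rintro v ⟨hv, hav : a v = 0⟩
    obtain ⟨ε, hε, h⟩ := hC.exists_add_smul_mem hx hv
    have := (vectorSpan ℝ (C ∩ {v | a v = 0})).smul_mem ε⁻¹
      (vsub_mem_vectorSpan ℝ (show x + ε • v ∈ C ∩ {v | a v = 0} from ⟨h, by simp [hax, hav]⟩)
        (show x ∈ C ∩ {v | a v = 0} from ⟨hx, hax⟩))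
    simpa [smul_smul, inv_mul_cancel₀ hε.ne'] using this

open Classical in
/-- The Euler characteristic with compact support of a relatively open convex set. -/
noncomputable def openEuler (C : Set V) : ℤ :=
  if C = ∅ then 0 else (-1) ^ Module.finrank ℝ (vectorSpan ℝ C)

theorem openEuler_empty : openEuler (∅ : Set V) = 0 := if_pos rfl

theorem openEuler_of_mem {C : Set V} {x : V} (hx : x ∈ C) :
    openEuler C = (-1) ^ Module.finrank ℝ (vectorSpan ℝ C) :=
  if_neg (Set.nonempty_iff_ne_empty.1 ⟨x, hx⟩)

/-- The sum of `openEuler` over the pieces into which the signs of some functionals cut a set. -/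
noncomputable def signSum : List (Module.Dual ℝ V) → Set V → ℤ
  | [], C => openEuler C
  | a :: L, C => signSum L (C ∩ {v | 0 < a v}) + signSum L (C ∩ {v | a v = 0}) +
      signSum L (C ∩ {v | a v < 0})

/-- If a takes both signs on C, the two open sides keep the dimension n and the slice has dimension
n - 1, so the sum is 2(-1)^n - (-1)^n. Otherwise relative openness puts C entirely in one of the
three pieces. -/
theorem IsRelOpen.openEuler_split [FiniteDimensional ℝ V] {C : Set V} (hC : IsRelOpen C)
    (a : Module.Dual ℝ V) :
    openEuler (C ∩ {v | 0 < a v}) + openEuler (C ∩ {v | a v = 0}) +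
      openEuler (C ∩ {v | a v < 0}) = openEuler C := by
  by_cases hp : ∃ x ∈ C, 0 < a x
  · obtain ⟨x, hx, hax⟩ := hp
    by_cases hn : ∃ y ∈ C, a y ≤ 0
    · obtain ⟨y, hy, hay⟩ := hn
      obtain ⟨w, hw, haw⟩ : ∃ w ∈ C, a w < 0 := by
        obtain ⟨ε, hε, h⟩ := hC.2 y hy x hx
        refine ⟨_, h, ?_⟩
        simp only [map_add, map_smul, map_sub, smul_eq_mul]
        nlinarith
      obtain ⟨z, hz, haz⟩ : ∃ z ∈ C, a z = 0 := by
        refine ⟨_, hC.1 hx hw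
          (show 0 ≤ -a w / (a x - a w) from div_nonneg (by linarith) (by linarith))
          (show 0 ≤ a x / (a x - a w) from div_nonneg (by linarith) (by linarith)) ?_, ?_⟩
        · have : a x - a w ≠ 0 := by linarith
          field_simp
          ring
        · simp only [map_add, map_smul, smul_eq_mul]
          ring
      rw [openEuler_of_mem (C := C) hx, openEuler_of_mem (C := C ∩ {v | 0 < a v}) ⟨hx, hax⟩,
        openEuler_of_mem (C := C ∩ {v | a v < 0}) ⟨hw, haw⟩,
        openEuler_of_mem (C := C ∩ {v | a v = 0}) ⟨hz, haz⟩, vectorSpan_inter_pos hC.1 a hx hax,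
        vectorSpan_inter_neg hC.1 a hw haw, hC.vectorSpan_inter_zero a hz haz]
      have hv : x - z ∈ vectorSpan ℝ C := vsub_mem_vectorSpan ℝ hx hz
      have hker : ¬ vectorSpan ℝ C ≤ LinearMap.ker a := fun h => by
        have : a (x - z) = 0 := h hv
        rw [map_sub, haz] at this
        linarith
      have hrank : Module.finrank ℝ (vectorSpan ℝ C) =
          Module.finrank ℝ (vectorSpan ℝ C ⊓ LinearMap.ker a : Submodule ℝ V) + 1 := by
        have h1 := LinearMap.finrank_range_add_finrank_ker (a.domRestrict (vectorSpan ℝ C))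
        have h2 : LinearMap.range (a.domRestrict (vectorSpan ℝ C)) = ⊤ := by
          rw [LinearMap.range_eq_top]
          apply LinearMap.surjective
          intro h0
          apply hker
          intro v hv
          exact LinearMap.congr_fun h0 ⟨v, hv⟩
        have h3 : Module.finrank ℝ (LinearMap.ker (a.domRestrict (vectorSpan ℝ C))) =
            Module.finrank ℝ (vectorSpan ℝ C ⊓ LinearMap.ker a : Submodule ℝ V) := by
          rw [LinearMap.ker_domRestrict, ← Submodule.finrank_map_subtype_eq,
            Submodule.map_comap_subtype]
        rw [h2, finrank_top, Module.finrank_self] at h1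
        omega
      rw [hrank, pow_succ]
      ring
    · push Not at hn
      have h1 : C ∩ {v | 0 < a v} = C := Set.inter_eq_left.2 hn
      have h2 : C ∩ {v | a v = 0} = ∅ := by
        ext v; simp only [Set.mem_inter_iff, Set.mem_ofPred_eq, Set.mem_empty_iff_false, iff_false]
        exact fun h => (hn v h.1).ne' h.2
      have h3 : C ∩ {v | a v < 0} = ∅ := by
        ext v; simp only [Set.mem_inter_iff, Set.mem_ofPred_eq, Set.mem_empty_iff_false, iff_false]
        exact fun h => (hn v h.1).not_gt h.2
      rw [h1, h2, h3, openEuler_empty]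
      ring
  · push Not at hp
    have h1 : C ∩ {v | 0 < a v} = ∅ := by
      ext v; simp only [Set.mem_inter_iff, Set.mem_ofPred_eq, Set.mem_empty_iff_false, iff_false]
      exact fun h => (hp v h.1).not_gt h.2
    by_cases hz : ∃ z ∈ C, a z = 0
    · obtain ⟨z, hz, haz⟩ := hz
      have h0 : ∀ v ∈ C, a v = 0 := by
        intro v hv
        obtain ⟨ε, hε, h⟩ := hC.2 z hz v hv
        have := hp _ h
        simp only [map_add, map_smul, map_sub, smul_eq_mul, haz, zero_sub, zero_add] at this
        refine le_antisymm (hp v hv) ?_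
        by_contra hlt
        nlinarith
      have h2 : C ∩ {v | a v = 0} = C := Set.inter_eq_left.2 h0
      have h3 : C ∩ {v | a v < 0} = ∅ := by
        ext v; simp only [Set.mem_inter_iff, Set.mem_ofPred_eq, Set.mem_empty_iff_false, iff_false]
        exact fun h => h.2.ne (h0 v h.1)
      rw [h1, h2, h3, openEuler_empty]
      ring
    · push Not at hz
      have h2 : C ∩ {v | a v = 0} = ∅ := by
        ext v; simp only [Set.mem_inter_iff, Set.mem_ofPred_eq, Set.mem_empty_iff_false, iff_false]
        exact fun h => hz v h.1 h.2
      have h3 : C ∩ {v | a v < 0} = C :=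
        Set.inter_eq_left.2 fun v hv => lt_of_le_of_ne (hp v hv) (hz v hv)
      rw [h1, h2, h3, openEuler_empty]
      ring

theorem IsRelOpen.signSum_eq [FiniteDimensional ℝ V] (L : List (Module.Dual ℝ V)) {C : Set V}
    (hC : IsRelOpen C) : signSum L C = openEuler C := by
  induction L generalizing C with
  | nil => rfl
  | cons a L ih =>
    rw [signSum, ih (hC.inter_pos a), ih (hC.inter_zero a), ih (hC.inter_neg a),
      hC.openEuler_split a]

/-- Once all functionals of the list have been used to cut, at most one part meets each piece, and
the piece equals that part. -/
theorem signSum_eq_sum {ι : Type*} (L : List (Module.Dual ℝ V)) (C : Set V) (J : Finset ι)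
    (D : ι → Set V) (hcover : ∀ x, x ∈ C ↔ ∃ j ∈ J, x ∈ D j)
    (hdet : ∀ i ∈ J, ∀ j ∈ J, ∀ x ∈ D i, ∀ y ∈ D j,
      (∀ a ∈ L, SignType.sign (a x) = SignType.sign (a y)) → i = j) :
    signSum L C = ∑ j ∈ J, signSum L (D j) := by
  induction L generalizing C D with
  | nil =>
    simp only [signSum]
    rcases C.eq_empty_or_nonempty with rfl | ⟨x, hx⟩
    · rw [openEuler_empty, Finset.sum_eq_zero]
      intro j hj
      have : D j = ∅ := Set.eq_empty_iff_forall_notMem.2 fun x hx => (hcover x).2 ⟨j, hj, hx⟩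
      rw [this, openEuler_empty]
    · obtain ⟨i, hi, hxi⟩ := (hcover x).1 hx
      have hother : ∀ j ∈ J, ∀ y ∈ D j, j = i :=
        fun j hj y hy => hdet j hj i hi y hy x hxi (by simp)
      rw [Finset.sum_eq_single_of_mem i hi]
      · congr 1
        ext y
        rw [hcover]
        exact ⟨fun ⟨j, hj, hy⟩ => hother j hj y hy ▸ hy, fun hy => ⟨i, hi, hy⟩⟩
      · intro j hj hne
        have : D j = ∅ := Set.eq_empty_iff_forall_notMem.2 fun y hy => hne (hother j hj y hy)
        rw [this, openEuler_empty]
  | cons a L ih =>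
    have step : ∀ s : SignType, signSum L (C ∩ {v | SignType.sign (a v) = s}) =
        ∑ j ∈ J, signSum L (D j ∩ {v | SignType.sign (a v) = s}) := by
      intro s
      apply ih
      · intro x
        simp only [Set.mem_inter_iff, hcover]
        constructor
        · rintro ⟨⟨j, hj, hx⟩, hs⟩
          exact ⟨j, hj, hx, hs⟩
        · rintro ⟨j, hj, hx, hs⟩
          exact ⟨⟨j, hj, hx⟩, hs⟩
      · rintro i hi j hj x ⟨hx, hxs⟩ y ⟨hy, hys⟩ h
        refine hdet i hi j hj x hx y hy fun b hb => ?_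
        rcases List.mem_cons.1 hb with rfl | hb
        · exact hxs.trans hys.symm
        · exact h b hb
    have h1 := step 1
    have h2 := step 0
    have h3 := step (-1)
    simp only [sign_eq_one_iff, sign_eq_zero_iff, sign_eq_neg_one_iff] at h1 h2 h3
    simp only [signSum, Finset.sum_add_distrib, h1, h2, h3]

/-- Additivity of the Euler characteristic for a finite partition of a relatively open convex set
into relatively open convex sets, the parts of which are told apart by the signs of finitely many
functionals. -/
theorem IsRelOpen.openEuler_eq_sum [FiniteDimensional ℝ V] {ι : Type*}
    {A : Set (Module.Dual ℝ V)} (hA : A.Finite) {C : Set V} (hC : IsRelOpen C) (J : Finset ι)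
    (D : ι → Set V) (hD : ∀ j ∈ J, IsRelOpen (D j)) (hcover : ∀ x, x ∈ C ↔ ∃ j ∈ J, x ∈ D j)
    (hdet : ∀ i ∈ J, ∀ j ∈ J, ∀ x ∈ D i, ∀ y ∈ D j,
      (∀ a ∈ A, SignType.sign (a x) = SignType.sign (a y)) → i = j) :
    openEuler C = ∑ j ∈ J, openEuler (D j) := by
  rw [← hC.signSum_eq hA.toFinset.toList, signSum_eq_sum hA.toFinset.toList C J D hcover]
  · exact Finset.sum_congr rfl fun j hj => (hD j hj).signSum_eq _
  · simpa using hdet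

end RelOpen

/-! ### Exposed faces and open normal cones -/

section NormalCones

variable {E : Type*} [NormedAddCommGroup E] [NormedSpace ℝ E]

theorem toExposed_mem_faces (P : Set E) (l : StrongDual ℝ E) : l.toExposed P ∈ faces P :=
  ContinuousLinearMap.toExposed.isExposed

theorem exists_toExposed_eq {P F : Set E} (hF : F ∈ faces P) (hne : F.Nonempty) :
    ∃ l : StrongDual ℝ E, l.toExposed P = F := by
  obtain ⟨l, hl⟩ := hF hne
  exact ⟨l, hl.symm⟩

theorem IsPolytope.toExposed_nonempty {P : Set E} (hP : IsPolytope P) (hne : P.Nonempty)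
    (l : StrongDual ℝ E) : (l.toExposed P).Nonempty := by
  obtain ⟨x, hx, hmax⟩ := hP.isCompact.exists_isMaxOn hne l.continuous.continuousOn
  exact ⟨x, hx, fun y hy => hmax hy⟩

theorem le_of_forall_mem_le {S : Set E} (l : StrongDual ℝ E) (c : ℝ) (h : ∀ s ∈ S, l s ≤ c) :
    ∀ x ∈ convexHull ℝ S, l x ≤ c :=
  fun _ hx => convexHull_min h ((convex_Iic c).linear_preimage l.toLinearMap) hx

theorem mem_toExposed_convexHull {S : Set E} (l : StrongDual ℝ E) {x : E}
    (hx : x ∈ convexHull ℝ S) : x ∈ l.toExposed (convexHull ℝ S) ↔ ∀ s ∈ S, l s ≤ l x :=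
  ⟨fun h s hs => h.2 s (subset_convexHull ℝ S hs), fun h => ⟨hx, le_of_forall_mem_le l _ h⟩⟩

/-- A small perturbation of a functional exposes a face of the face exposed by the functional. -/
theorem IsPolytope.exists_toExposed_add_smul {P : Set E} (hP : IsPolytope P)
    (l m : StrongDual ℝ E) :
    ∃ ε : ℝ, 0 < ε ∧ (l + ε • m).toExposed P = m.toExposed (l.toExposed P) := by
  rcases P.eq_empty_or_nonempty with rfl | hne
  · exact ⟨1, one_pos, by ext; simp [ContinuousLinearMap.toExposed]⟩
  have hface := hP.face (toExposed_mem_faces P l)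
  obtain ⟨g, hg⟩ := hface.toExposed_nonempty (hP.toExposed_nonempty hne l) m
  obtain ⟨S, hS, rfl⟩ := hP
  -- For small ε the finitely many generators off the face of l stay strictly below g, so only
  -- generators on that face compete, and there m decides.
  have hev : ∀ᶠ ε : ℝ in nhdsWithin 0 (Set.Ioi 0), ∀ s ∈ S, l s < l g →
      l s + ε * m s < l g + ε * m g := by
    rw [Filter.eventually_all_finite hS]
    intro s _
    by_cases hs : l s < l g
    · have hcont : Continuous fun ε : ℝ => l g + ε * m g - (l s + ε * m s) := by fun_prop
      have := (hcont.tendsto 0).eventually (lt_mem_nhds (a := 0) (by simpa using hs))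
      filter_upwards [nhdsWithin_le_nhds this] with ε hε _
      simpa using hε
    · exact Filter.Eventually.of_forall fun ε h => absurd h hs
  obtain ⟨ε, hε, hpos : 0 < ε⟩ := (hev.and self_mem_nhdsWithin).exists
  refine ⟨ε, hpos, ?_⟩
  have hmem : ∀ s ∈ S, l s = l g → s ∈ l.toExposed (convexHull ℝ S) := fun s hs h =>
    ⟨subset_convexHull ℝ S hs, fun y hy => (hg.1.2 y hy).trans h.ge⟩
  have hle : ∀ s ∈ S, l s ≤ l g := fun s hs => hg.1.2 s (subset_convexHull ℝ S hs)
  have hgm : g ∈ (l + ε • m).toExposed (convexHull ℝ S) := by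
    rw [mem_toExposed_convexHull _ hg.1.1]
    intro s hs
    simp only [add_apply, smul_apply, smul_eq_mul]
    rcases (hle s hs).lt_or_eq with h | h
    · exact (hε s hs h).le
    · have := mul_le_mul_of_nonneg_left (hg.2 s (hmem s hs h)) hpos.le
      linarith
  apply Set.Subset.antisymm
  · rw [face_eq_convexHull hS (toExposed_mem_faces _ (l + ε • m))]
    refine convexHull_min ?_ ((hface.face (toExposed_mem_faces _ m)).convex)
    rintro s ⟨hs, hsm⟩
    have h1 := hsm.2 g hg.1.1
    simp only [add_apply, smul_apply, smul_eq_mul] at h1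
    have h2 : l s = l g := by
      rcases (hle s hs).lt_or_eq with h | h
      · linarith [hε s hs h]
      · exact h
    refine ⟨hmem s hs h2, fun y hy => (hg.2 y hy).trans ?_⟩
    exact le_of_mul_le_mul_left (by linarith) hpos
  · intro x hx
    have h1 := hg.1.2 x hx.1.1
    have h2 := hx.1.2 g hg.1.1
    have h3 := hx.2 g hg.1
    refine ⟨hx.1.1, fun y hy => (hgm.2 y hy).trans ?_⟩
    simp only [add_apply, smul_apply, smul_eq_mul]
    have := mul_le_mul_of_nonneg_left h3 hpos.le
    linarith

/-- If l exposes F and m exposes a face of F, then l + εm exposes that face in P for a suitable ε >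
0. -/
theorem IsPolytope.faces_face {P F : Set E} (hP : IsPolytope P) (hF : F ∈ faces P) :
    faces F = {G ∈ faces P | G ⊆ F} := by
  ext G
  constructor
  · intro hG
    have hGF : G ⊆ F := IsExposed.subset hG
    refine ⟨fun hne => ?_, hGF⟩
    obtain ⟨l, rfl⟩ := exists_toExposed_eq hF (hne.mono hGF)
    obtain ⟨m, rfl⟩ := exists_toExposed_eq hG hne
    obtain ⟨ε, -, h⟩ := hP.exists_toExposed_add_smul l m
    exact ⟨l + ε • m, h.symm⟩
  · rintro ⟨hG, hGF⟩
    exact IsExposed.mono hG (IsExposed.subset hF) hGF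

/-- The signs on differences order the generators, and the exposed face is the hull of the top ones.
Thus finitely many hyperplanes in the dual space resolve the normal fan. -/
theorem toExposed_eq_of_sign_eq {S : Set E} (hS : S.Finite) {l m : StrongDual ℝ E}
    (h : ∀ s ∈ S, ∀ t ∈ S, SignType.sign (l (s - t)) = SignType.sign (m (s - t))) :
    l.toExposed (convexHull ℝ S) = m.toExposed (convexHull ℝ S) := by
  have hle : ∀ s ∈ S, ∀ t ∈ S, (l s ≤ l t ↔ m s ≤ m t) := by
    intro s hs t ht
    have := h s hs t ht
    rw [← sub_nonpos, ← map_sub, ← sub_nonpos (a := m s), ← map_sub, ← sign_nonpos_iff, this,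
      sign_nonpos_iff]
  rw [face_eq_convexHull hS (toExposed_mem_faces _ l),
    face_eq_convexHull hS (toExposed_mem_faces _ m)]
  congr 1
  ext s
  refine and_congr_right fun hs => ?_
  rw [mem_toExposed_convexHull l (subset_convexHull ℝ S hs),
    mem_toExposed_convexHull m (subset_convexHull ℝ S hs)]
  exact forall₂_congr fun t ht => hle t ht s hs

/-- The functionals that are constant on a set. -/
def constOn (F : Set E) : Submodule ℝ (StrongDual ℝ E) where
  carrier := {m | ∀ x ∈ F, ∀ y ∈ F, m x = m y}
  zero_mem' := by simp
  add_mem' := by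
    intro a b ha hb x hx y hy
    simp [ha x hx y hy, hb x hx y hy]
  smul_mem' := by
    intro c a ha x hx y hy
    simp [ha x hx y hy]

theorem mem_constOn {F : Set E} {m : StrongDual ℝ E} :
    m ∈ constOn F ↔ ∀ x ∈ F, ∀ y ∈ F, m x = m y := Iff.rfl

/-- `constOn F` is the annihilator of the direction space of F. -/
theorem finrank_constOn [FiniteDimensional ℝ E] (F : Set E) :
    Module.finrank ℝ (vectorSpan ℝ F) + Module.finrank ℝ (constOn F) = Module.finrank ℝ E := by
  have h : (constOn F).map
      (LinearMap.toContinuousLinearMap (𝕜 := ℝ) (E := E) (F' := ℝ)).symm.toLinearMap =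
        (vectorSpan ℝ F).dualAnnihilator := by
    ext m
    rw [Submodule.mem_dualAnnihilator, Submodule.mem_map]
    constructor
    · rintro ⟨l, hl, rfl⟩ v hv
      have : vectorSpan ℝ F ≤ LinearMap.ker l.toLinearMap := by
        rw [vectorSpan_def, Submodule.span_le]
        rintro _ ⟨x, hx, y, hy, rfl⟩
        simp [hl x hx y hy]
      exact this hv
    · intro hm
      refine ⟨LinearMap.toContinuousLinearMap m, fun x hx y hy => ?_, by ext; simp⟩
      have := hm _ (vsub_mem_vectorSpan ℝ hx hy)
      simpa [sub_eq_zero] using this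
  rw [← Subspace.finrank_add_finrank_dualAnnihilator_eq (vectorSpan ℝ F), ← h,
    LinearEquiv.finrank_map_eq]

/-- The relatively open normal cone of a face: the functionals that expose it. -/
def openNormalCone (P F : Set E) : Set (StrongDual ℝ E) :=
  {l | l.toExposed P = F}

theorem apply_eq_of_mem_toExposed {P : Set E} {l : StrongDual ℝ E} {x y : E}
    (hx : x ∈ l.toExposed P) (hy : y ∈ l.toExposed P) : l x = l y :=
  le_antisymm (hy.2 x hx.1) (hx.2 y hy.1)

theorem openNormalCone_subset_constOn (P F : Set E) :
    openNormalCone P F ⊆ (constOn F : Set (StrongDual ℝ E)) := by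
  rintro l rfl x hx y hy
  exact apply_eq_of_mem_toExposed hx hy

theorem toExposed_eq_self {F : Set E} {m : StrongDual ℝ E} (hm : m ∈ constOn F) :
    m.toExposed F = F :=
  Set.Subset.antisymm (fun _ hx => hx.1) fun x hx => ⟨hx, fun y hy => (hm y hy x hx).le⟩

theorem toExposed_add {P : Set E} {l m : StrongDual ℝ E} {g : E} (hl : g ∈ l.toExposed P)
    (hm : g ∈ m.toExposed P) : (l + m).toExposed P = l.toExposed P ∩ m.toExposed P := by
  ext x
  constructor
  · rintro ⟨hx, h⟩
    have h1 := hl.2 x hx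
    have h2 := hm.2 x hx
    have h3 := h g hl.1
    simp only [add_apply] at h3
    exact ⟨⟨hx, fun y hy => (hl.2 y hy).trans (by linarith)⟩,
      ⟨hx, fun y hy => (hm.2 y hy).trans (by linarith)⟩⟩
  · rintro ⟨hx, hx'⟩
    exact ⟨hx.1, fun y hy => add_le_add (hx.2 y hy) (hx'.2 y hy)⟩

theorem toExposed_smul {P : Set E} (l : StrongDual ℝ E) {c : ℝ} (hc : 0 < c) :
    (c • l).toExposed P = l.toExposed P := by
  ext x
  refine and_congr_right fun _ => forall₂_congr fun y _ => ?_
  simp [hc]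

/-- Functionals with a common maximizer expose, when added, the intersection of their faces, whence
convexity. Two members differ by a functional constant on F, and a small perturbation by such a
functional still exposes F. -/
theorem IsPolytope.isRelOpen_openNormalCone {P F : Set E} (hP : IsPolytope P) (hF : F.Nonempty) :
    IsRelOpen (openNormalCone P F) := by
  constructor
  · rw [convex_iff_forall_pos]
    rintro l hl m hm a b ha hb -
    obtain ⟨g, hg⟩ := hF
    rw [openNormalCone, Set.mem_ofPred_eq] at hl hm ⊢
    rw [← toExposed_smul l ha] at hl
    rw [← toExposed_smul m hb] at hm
    rw [toExposed_add (g := g) (by rwa [hl]) (by rwa [hm]), hl, hm, Set.inter_self]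
  · intro l hl m hm
    obtain ⟨ε, hε, h⟩ := hP.exists_toExposed_add_smul l (l - m)
    refine ⟨ε, hε, h.trans ?_⟩
    rw [show l.toExposed P = F from hl]
    exact toExposed_eq_self ((constOn F).sub_mem (openNormalCone_subset_constOn P F hl)
      (openNormalCone_subset_constOn P F hm))

theorem IsPolytope.vectorSpan_openNormalCone {P F : Set E} (hP : IsPolytope P)
    {l : StrongDual ℝ E} (hl : l ∈ openNormalCone P F) :
    vectorSpan ℝ (openNormalCone P F) = constOn F := by
  apply le_antisymm
  · rw [vectorSpan_def, Submodule.span_le]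
    rintro _ ⟨a, ha, b, hb, rfl⟩
    exact (constOn F).sub_mem (openNormalCone_subset_constOn P F ha)
      (openNormalCone_subset_constOn P F hb)
  · intro m hm
    obtain ⟨ε, hε, h⟩ := hP.exists_toExposed_add_smul l m
    rw [show l.toExposed P = F from hl, toExposed_eq_self hm] at h
    have := (vectorSpan ℝ (openNormalCone P F)).smul_mem ε⁻¹
      (vsub_mem_vectorSpan ℝ (show l + ε • m ∈ openNormalCone P F from h) hl)
    simpa [smul_smul, inv_mul_cancel₀ hε.ne'] using this

/-- The set is C + ℝv, the form in which boundary cones are projected along a direction. -/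
theorem IsRelOpen.add_span_singleton {V : Type*} [AddCommGroup V] [Module ℝ V] {C : Set V}
    (hC : IsRelOpen C) (v : V) : IsRelOpen {x | ∃ t : ℝ, x + t • v ∈ C} := by
  constructor
  · rintro x ⟨t, ht⟩ y ⟨s, hs⟩ a b ha hb hab
    refine ⟨a * t + b * s, ?_⟩
    convert hC.1 ht hs ha hb hab using 1
    module
  · rintro x ⟨t, ht⟩ y ⟨s, hs⟩
    obtain ⟨ε, hε, h⟩ := hC.2 _ ht _ hs
    refine ⟨ε, hε, t + ε * (t - s), ?_⟩
    convert h using 1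
    module

theorem vectorSpan_add_span_singleton {V : Type*} [AddCommGroup V] [Module ℝ V] {C : Set V}
    {c : V} (hc : c ∈ C) (v : V) :
    vectorSpan ℝ {x | ∃ t : ℝ, x + t • v ∈ C} = vectorSpan ℝ C ⊔ ℝ ∙ v := by
  apply le_antisymm
  · rw [vectorSpan_def, Submodule.span_le]
    rintro _ ⟨x, ⟨t, ht⟩, y, ⟨s, hs⟩, rfl⟩
    have : x - y = ((x + t • v) -ᵥ (y + s • v)) + (s - t) • v := by
      simp only [vsub_eq_sub]
      module
    change x - y ∈ _
    rw [this]
    exact Submodule.add_mem_sup (vsub_mem_vectorSpan ℝ ht hs)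
      (Submodule.smul_mem _ _ (Submodule.mem_span_singleton_self v))
  · refine sup_le (vectorSpan_mono ℝ fun x hx => ⟨0, by simpa using hx⟩) ?_
    rw [Submodule.span_singleton_le_iff_mem]
    have := vsub_mem_vectorSpan ℝ (s := {x | ∃ t : ℝ, x + t • v ∈ C}) (p₁ := c + v) (p₂ := c)
      ⟨-1, by simpa using hc⟩ ⟨0, by simpa using hc⟩
    simpa using this

end NormalCones

/-! ### Face signs as Euler characteristics of cones; Euler's relation -/

section AlternatingSums

variable {E : Type*} [NormedAddCommGroup E] [NormedSpace ℝ E]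

/-- Evaluation at a point, as a functional on the dual space. -/
def evalDual (x : E) : Module.Dual ℝ (StrongDual ℝ E) where
  toFun l := l x
  map_add' _ _ := rfl
  map_smul' _ _ := rfl

@[simp]
theorem evalDual_apply (x : E) (l : StrongDual ℝ E) : evalDual x l = l x := rfl

/-- The sign `(-1) ^ dim F`. -/
noncomputable def faceSign (F : Set E) : ℤ :=
  (((-1 : ℤˣ) ^ dim F : ℤˣ) : ℤ)

theorem faceSign_empty : faceSign (∅ : Set E) = -1 := by
  simp [faceSign, dim]

theorem dim_of_nonempty {F : Set E} (hF : F.Nonempty) :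
    dim F = (Module.finrank ℝ (vectorSpan ℝ F) : ℤ) := by
  rw [dim, if_neg hF.ne_empty]

theorem faceSign_of_nonempty {F : Set E} (hF : F.Nonempty) :
    faceSign F = (-1) ^ Module.finrank ℝ (vectorSpan ℝ F) := by
  rw [faceSign, dim_of_nonempty hF, zpow_natCast]
  simp

theorem neg_one_pow_finrank_constOn [FiniteDimensional ℝ E] (F : Set E) :
    (-1 : ℤ) ^ Module.finrank ℝ (constOn F) =
      (-1) ^ Module.finrank ℝ E * (-1) ^ Module.finrank ℝ (vectorSpan ℝ F) := by
  rw [← finrank_constOn F, ← pow_add]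
  have : Module.finrank ℝ (vectorSpan ℝ F) + Module.finrank ℝ (constOn F) +
      Module.finrank ℝ (vectorSpan ℝ F) =
        2 * Module.finrank ℝ (vectorSpan ℝ F) + Module.finrank ℝ (constOn F) := by ring
  rw [this, pow_add, pow_mul]
  simp

theorem IsPolytope.openEuler_openNormalCone {P F : Set E} (hP : IsPolytope P) (hF : F ∈ faces P)
    (hne : F.Nonempty) :
    openEuler (openNormalCone P F) = (-1) ^ Module.finrank ℝ (constOn F) := by
  obtain ⟨l, hl⟩ := exists_toExposed_eq hF hne
  rw [openEuler_of_mem (x := l) hl, hP.vectorSpan_openNormalCone (l := l) hl]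

theorem isRelOpen_submodule {V : Type*} [AddCommGroup V] [Module ℝ V] (W : Submodule ℝ V) :
    IsRelOpen (W : Set V) :=
  ⟨W.convex, fun _ hx _ hy => ⟨1, one_pos, W.add_mem hx (W.smul_mem 1 (W.sub_mem hx hy))⟩⟩

theorem openEuler_submodule {V : Type*} [AddCommGroup V] [Module ℝ V] (W : Submodule ℝ V) :
    openEuler (W : Set V) = (-1) ^ Module.finrank ℝ W := by
  have h : vectorSpan ℝ (W : Set V) = W := by
    rw [vectorSpan_eq_span_vsub_set_right ℝ W.zero_mem]
    simp
  rw [openEuler_of_mem W.zero_mem, h]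

/-- Additivity of the Euler characteristic over the relatively open cones of the normal fan. -/
theorem IsPolytope.openEuler_eq_sum_openNormalCone [FiniteDimensional ℝ E] {P : Set E}
    (hP : IsPolytope P) {C : Set (StrongDual ℝ E)} (hC : IsRelOpen C) (J : Finset (Set E))
    (hJ : ∀ F ∈ J, F.Nonempty) (hcover : ∀ l, l ∈ C ↔ l.toExposed P ∈ J) :
    openEuler C = ∑ F ∈ J, openEuler (openNormalCone P F) := by
  have hP' := hP
  obtain ⟨S, hS, rfl⟩ := hP
  refine hC.openEuler_eq_sum ((hS.prod hS).image fun s => evalDual (s.1 - s.2)) J _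
    (fun F hF => hP'.isRelOpen_openNormalCone (hJ F hF)) (fun l => ?_) ?_
  · rw [hcover]
    exact ⟨fun h => ⟨_, h, rfl⟩, fun ⟨F, hF, h⟩ => (show l.toExposed _ = F from h) ▸ hF⟩
  · rintro F - G - l rfl m rfl h
    exact toExposed_eq_of_sign_eq hS fun s hs t ht => h _ ⟨(s, t), ⟨hs, ht⟩, rfl⟩

/-- Euler's relation. -/
theorem IsPolytope.sum_faceSign [FiniteDimensional ℝ E] {P : Set E} (hP : IsPolytope P)
    (hne : P.Nonempty) : ∑ F ∈ hP.finite_faces.toFinset, faceSign F = 0 := by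
  classical
  have hJ : hP.finite_faces.toFinset =
      insert ∅ (hP.finite_faces.toFinset.filter Set.Nonempty) := by
    ext F
    rcases F.eq_empty_or_nonempty with rfl | hF
    · simpa using (show ∅ ∈ faces P from isExposed_empty)
    · simp [hF, hF.ne_empty]
  -- `constOn ∅` is the whole dual space. The nonempty faces will contribute 1, which the sign -1 of
  -- the empty face cancels.
  have hsum := hP.openEuler_eq_sum_openNormalCone (isRelOpen_submodule (constOn (∅ : Set E)))
    (hP.finite_faces.toFinset.filter Set.Nonempty) (by simp) (fun l => by
      simp [mem_constOn, toExposed_mem_faces, hP.toExposed_nonempty hne])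
  have hterm : ∀ F ∈ hP.finite_faces.toFinset.filter Set.Nonempty,
      openEuler (openNormalCone P F) = (-1) ^ Module.finrank ℝ E * faceSign F := by
    intro F hF
    rw [Finset.mem_filter, Set.Finite.mem_toFinset] at hF
    rw [hP.openEuler_openNormalCone hF.1 hF.2, neg_one_pow_finrank_constOn,
      faceSign_of_nonempty hF.2]
  rw [Finset.sum_congr rfl hterm, openEuler_submodule, neg_one_pow_finrank_constOn,
    vectorSpan_empty, finrank_bot, pow_zero, ← Finset.mul_sum] at hsum
  have h1 := mul_left_cancel₀ (pow_ne_zero _ (by norm_num)) hsum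
  rw [hJ, Finset.sum_insert (by simp), faceSign_empty, ← h1]
  norm_num

/-! ### Projecting the boundary of a normal cone along an interior direction -/

/-- The functional on the line through `l` in direction `m` that takes equal values at `q` and
`g`. -/
noncomputable def levelShift (m : StrongDual ℝ E) (g q : E) : StrongDual ℝ E →ₗ[ℝ] StrongDual ℝ E :=
  LinearMap.id + ((m (g - q))⁻¹ • evalDual (q - g)).smulRight m

theorem levelShift_apply (m : StrongDual ℝ E) (g q : E) (l : StrongDual ℝ E) :
    levelShift m g q l = l + (l (q - g) / m (g - q)) • m := by
  simp [levelShift, div_eq_inv_mul]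

theorem levelShift_add_smul_eq {m : StrongDual ℝ E} {g q : E} {l : StrongDual ℝ E} {t : ℝ}
    (hm : m q < m g) (h : (l + t • m) q = (l + t • m) g) : levelShift m g q l = l + t • m := by
  rw [levelShift_apply]
  congr 2
  rw [div_eq_iff (by rw [map_sub]; linarith)]
  simp only [add_apply, smul_apply, smul_eq_mul] at h
  rw [map_sub, map_sub]
  linarith

theorem exists_mem_notMem_of_not_subset {T F G : Set E} (hT : T.Finite)
    (hF : F ∈ faces (convexHull ℝ T)) (hG : Convex ℝ G) (h : ¬ F ⊆ G) :
    ∃ q ∈ T, q ∈ F ∧ q ∉ G := by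
  by_contra! hcon
  apply h
  rw [face_eq_convexHull hT hF]
  exact convexHull_min (fun q hq => hcon q hq.1 hq.2) hG

/-- A line in direction m meets the boundary at most once: if g is maximal at parameter s, then any
further positive multiple of m shrinks the exposed face into that of m. -/
theorem eq_of_not_subset_toExposed_add_smul {Q : Set E} {m y : StrongDual ℝ E} {g : E} {s t : ℝ}
    (hg : g ∈ m.toExposed Q) (hs : g ∈ (y + s • m).toExposed Q)
    (hs' : ¬ (y + s • m).toExposed Q ⊆ m.toExposed Q) (ht : g ∈ (y + t • m).toExposed Q)
    (ht' : ¬ (y + t • m).toExposed Q ⊆ m.toExposed Q) : s = t := by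
  have key : ∀ {s t : ℝ}, s < t → g ∈ (y + s • m).toExposed Q →
      (y + t • m).toExposed Q ⊆ m.toExposed Q := by
    intro s t hst h
    have hm : ((t - s) • m).toExposed Q = m.toExposed Q := toExposed_smul m (sub_pos.2 hst)
    have : y + t • m = (y + s • m) + (t - s) • m := by module
    rw [this, toExposed_add h (by rwa [hm]), hm]
    exact Set.inter_subset_right
  rcases lt_trichotomy s t with h | h | h
  · exact absurd (key h hs) ht'
  · exact h
  · exact absurd (key h ht) hs'

/-- The line w + tm meets the boundary at least once. The point g is maximal for w + tm exactly when
t is at least every ratio w(q - g) / m(g - q) with q outside the face; at the largest ratio the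
corresponding q joins g. -/
theorem exists_levelShift_mem {T : Set E} (hT : T.Finite) {m : StrongDual ℝ E} {g : E}
    (hg : g ∈ m.toExposed (convexHull ℝ T))
    (hne : m.toExposed (convexHull ℝ T) ≠ convexHull ℝ T) {w : StrongDual ℝ E}
    (hw : w ∈ constOn (m.toExposed (convexHull ℝ T))) :
    ∃ q ∈ T, q ∉ m.toExposed (convexHull ℝ T) ∧
      g ∈ (levelShift m g q w).toExposed (convexHull ℝ T) ∧
      q ∈ (levelShift m g q w).toExposed (convexHull ℝ T) := by
  have hsub : ∀ q ∈ T, q ∈ convexHull ℝ T := fun q hq => subset_convexHull ℝ T hq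
  have hlt : ∀ q ∈ T, q ∉ m.toExposed (convexHull ℝ T) → m q < m g := by
    intro q hq hqm
    refine lt_of_le_of_ne (hg.2 q (hsub q hq)) fun h => hqm ⟨hsub q hq, fun y hy => ?_⟩
    exact (hg.2 y hy).trans h.ge
  have hT' : ({q ∈ T | q ∉ m.toExposed (convexHull ℝ T)}).Nonempty := by
    obtain ⟨q, hq, -, hqm⟩ := exists_mem_notMem_of_not_subset hT
      (IsExposed.refl (convexHull ℝ T))
      (IsExposed.convex (toExposed_mem_faces (convexHull ℝ T) m) (convex_convexHull ℝ T))
      (fun h => hne (Set.Subset.antisymm (fun _ hx => hx.1) h))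
    exact ⟨q, hq, hqm⟩
  obtain ⟨q, ⟨hq, hqm⟩, hmax⟩ := Set.exists_max_image _
    (fun q => w (q - g) / m (g - q)) (hT.subset (Set.sep_subset _ _)) hT'
  have hpos : ∀ q ∈ T, q ∉ m.toExposed (convexHull ℝ T) → 0 < m (g - q) := by
    intro q hq hqm
    rw [map_sub, sub_pos]
    exact hlt q hq hqm
  have hval : ∀ x, levelShift m g q w x - levelShift m g q w g =
      w (x - g) - w (q - g) / m (g - q) * m (g - x) := by
    intro x
    simp only [levelShift_apply, add_apply, smul_apply, smul_eq_mul, map_sub]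
    ring
  have hgm : g ∈ (levelShift m g q w).toExposed (convexHull ℝ T) := by
    rw [mem_toExposed_convexHull _ hg.1]
    intro s hs
    rw [← sub_nonpos, hval]
    by_cases hsm : s ∈ m.toExposed (convexHull ℝ T)
    · simp [map_sub, hw s hsm g hg, apply_eq_of_mem_toExposed hsm hg]
    · have := hmax s ⟨hs, hsm⟩
      rw [div_le_iff₀ (hpos s hs hsm)] at this
      linarith
  have hqg : levelShift m g q w q = levelShift m g q w g := by
    rw [← sub_eq_zero, hval, div_mul_cancel₀ _ (hpos q hq hqm).ne', sub_self]
  exact ⟨q, hq, hqm, hgm, hsub q hq, fun y hy => (hgm.2 y hy).trans hqg.ge⟩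

/-- The cones of the normal fan of `P` in the relative boundary of the normal cone of a proper face
`G` of `Q` have total Euler characteristic opposite to that of the linear hull of that cone. -/
theorem IsPolytope.sum_openEuler_boundary [FiniteDimensional ℝ E] {P Q : Set E} (hP : IsPolytope P)
    (hQ : IsPolytope Q) {p : Set E → Set E} (hp : ∀ l : StrongDual ℝ E,
      p (l.toExposed P) = l.toExposed Q) (hPne : P.Nonempty) {G : Set E} (hG : G ∈ faces Q)
    (hGne : G.Nonempty) (hGQ : G ≠ Q) (J : Finset (Set E))
    (hJ : ∀ F, F ∈ J ↔ F ∈ faces P ∧ F.Nonempty ∧ G ⊂ p F) :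
    ∑ F ∈ J, openEuler (openNormalCone P F) = -(-1) ^ Module.finrank ℝ (constOn G) := by
  have hP' := hP
  obtain ⟨S, hS, rfl⟩ := hP
  obtain ⟨T, hT, rfl⟩ := hQ
  obtain ⟨m, rfl⟩ := exists_toExposed_eq hG hGne
  obtain ⟨g, hg⟩ := hGne
  have hconv : Convex ℝ (m.toExposed (convexHull ℝ T)) := IsExposed.convex hG (convex_convexHull ℝ T)
  have hJl : ∀ F ∈ J, ∃ l : StrongDual ℝ E, l.toExposed (convexHull ℝ S) = F ∧
      g ∈ l.toExposed (convexHull ℝ T) ∧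
      ¬ l.toExposed (convexHull ℝ T) ⊆ m.toExposed (convexHull ℝ T) := by
    intro F hF
    obtain ⟨hF, hFne, hsub⟩ := (hJ F).1 hF
    obtain ⟨l, rfl⟩ := exists_toExposed_eq hF hFne
    rw [hp] at hsub
    exact ⟨l, rfl, hsub.1 hg, hsub.2⟩
  -- If m were constant on F, then l + εm would expose F too, yet expose a subset of G in Q, where G
  -- is the face exposed by m. Hence adding ℝm raises the dimension of the cone by one and flips its
  -- sign.
  have hmJ : ∀ F ∈ J, m ∉ constOn F := by
    intro F hF hm
    obtain ⟨l, rfl, hgl, hl⟩ := hJl F hF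
    obtain ⟨ε, hε, h⟩ := hP'.exists_toExposed_add_smul l m
    rw [toExposed_eq_self hm] at h
    apply hl
    have hsm : (ε • m).toExposed (convexHull ℝ T) = m.toExposed (convexHull ℝ T) :=
      toExposed_smul m hε
    rw [← hp, ← h, hp, toExposed_add hgl (by rwa [hsm]), hsm]
    exact Set.inter_subset_right
  have hterm : ∀ F ∈ J, openEuler {x | ∃ t : ℝ, x + t • m ∈ openNormalCone (convexHull ℝ S) F} =
      -openEuler (openNormalCone (convexHull ℝ S) F) := by
    intro F hF
    have hm := hmJ F hF
    obtain ⟨l, hl, -, -⟩ := hJl F hF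
    have hl' : l ∈ openNormalCone (convexHull ℝ S) F := hl
    rw [openEuler_of_mem hl', openEuler_of_mem
        (show l ∈ {x | ∃ t : ℝ, x + t • m ∈ openNormalCone _ F} from ⟨0, by simpa using hl'⟩),
      vectorSpan_add_span_singleton hl', hP'.vectorSpan_openNormalCone hl',
      Submodule.finrank_sup_span_singleton hm, pow_succ]
    ring
  have hU : (S ∪ T).Finite := hS.union hT
  have hT' : ({q ∈ T | q ∉ m.toExposed (convexHull ℝ T)}).Finite := hT.subset (Set.sep_subset _ _)
  -- The separating functionals are signs of differences after a level shift: the shift is linear,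
  -- so its pullbacks are again functionals, and there is one shift for each generator q off the
  -- face.
  have hmain := (isRelOpen_submodule (constOn (m.toExposed (convexHull ℝ T)))).openEuler_eq_sum
    ((hT'.prod (hU.prod hU)).image fun a : E × E × E =>
      (evalDual (a.2.1 - a.2.2)).comp (levelShift m g a.1)) J
    (fun F => {x | ∃ t : ℝ, x + t • m ∈ openNormalCone (convexHull ℝ S) F})
    (fun F hF => (hP'.isRelOpen_openNormalCone ((hJ F).1 hF).2.1).add_span_singleton m) ?_ ?_
  · rw [openEuler_submodule, Finset.sum_congr rfl hterm, Finset.sum_neg_distrib] at hmain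
    rw [hmain, neg_neg]
  · intro w
    constructor
    · intro hw
      obtain ⟨q, hq, hqm, hgq, hqq⟩ := exists_levelShift_mem hT hg hGQ hw
      refine ⟨(levelShift m g q w).toExposed (convexHull ℝ S), ?_, w (q - g) / m (g - q), ?_⟩
      · rw [hJ, hp]
        refine ⟨toExposed_mem_faces _ _, hP'.toExposed_nonempty hPne _, fun x hx => ?_,
          fun h => hqm (h hqq)⟩
        refine ⟨hx.1, fun y hy => (hgq.2 y hy).trans (le_of_eq ?_)⟩
        rw [levelShift_apply]
        simp [hw g hg x hx, apply_eq_of_mem_toExposed hg hx]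
      · rw [← levelShift_apply]
        rfl
    · rintro ⟨F, hF, t, ht⟩
      obtain ⟨-, -, hsub⟩ := (hJ F).1 hF
      have ht' : (w + t • m).toExposed (convexHull ℝ S) = F := ht
      rw [← ht', hp] at hsub
      have h1 : w + t • m ∈ constOn (m.toExposed (convexHull ℝ T)) := fun x hx y hy =>
        apply_eq_of_mem_toExposed (hsub.1 hx) (hsub.1 hy)
      have h2 : m ∈ constOn (m.toExposed (convexHull ℝ T)) := fun x hx y hy =>
        apply_eq_of_mem_toExposed hx hy
      simpa using (constOn _).sub_mem h1 ((constOn _).smul_mem t h2)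
  · rintro F hF F' hF' x ⟨t, ht⟩ y ⟨t', ht'⟩ hsign
    have hsub := ((hJ F).1 hF).2.2
    have hsub' := ((hJ F').1 hF').2.2
    replace ht : (x + t • m).toExposed (convexHull ℝ S) = F := ht
    replace ht' : (y + t' • m).toExposed (convexHull ℝ S) = F' := ht'
    rw [← ht, hp] at hsub
    rw [← ht', hp] at hsub'
    -- For this q the level shift of x is x + tm itself. Equal signs make the shift of y expose the
    -- same faces of P and Q, so it too is a boundary point, and uniqueness on the line identifies
    -- it with y + t'm.
    obtain ⟨q, hqT, hq, hqm⟩ := exists_mem_notMem_of_not_subset hT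
      (toExposed_mem_faces _ (x + t • m)) hconv hsub.2
    have hmq : m q < m g := by
      refine lt_of_le_of_ne (hg.2 q hq.1) fun h => hqm ⟨hq.1, fun y hy => ?_⟩
      exact (hg.2 y hy).trans h.ge
    have hx : levelShift m g q x = x + t • m :=
      levelShift_add_smul_eq hmq (apply_eq_of_mem_toExposed hq (hsub.1 hg))
    have hsgn : ∀ s ∈ S ∪ T, ∀ s' ∈ S ∪ T, SignType.sign (levelShift m g q x (s - s')) =
        SignType.sign (levelShift m g q y (s - s')) := fun s hs s' hs' =>
      hsign _ ⟨(q, s, s'), ⟨⟨hqT, hqm⟩, hs, hs'⟩, rfl⟩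
    have hSeq := toExposed_eq_of_sign_eq hS fun s hs s' hs' =>
      hsgn s (Or.inl hs) s' (Or.inl hs')
    have hTeq := toExposed_eq_of_sign_eq hT fun s hs s' hs' =>
      hsgn s (Or.inr hs) s' (Or.inr hs')
    rw [hx, levelShift_apply] at hSeq hTeq
    rw [hTeq] at hsub
    have := eq_of_not_subset_toExposed_add_smul hg (hsub.1 hg) hsub.2 (hsub'.1 hg) hsub'.2
    rw [this, ht, ht'] at hSeq
    exact hSeq

/-- The alternating sum over the faces `F` of `P` whose part in `Q` contains a given proper face
of `Q`. -/
theorem IsPolytope.sum_faceSign_filter [FiniteDimensional ℝ E] {P Q : Set E} (hP : IsPolytope P)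
    (hQ : IsPolytope Q) {p : Set E → Set E} (hp0 : p ∅ = ∅) (hp : ∀ l : StrongDual ℝ E,
      p (l.toExposed P) = l.toExposed Q) (hPne : P.Nonempty) {G : Set E} (hG : G ∈ faces Q)
    (hGQ : G ≠ Q) [DecidablePred fun F => G ⊆ p F] :
    ∑ F ∈ hP.finite_faces.toFinset with G ⊆ p F, faceSign F = 0 := by
  classical
  rcases G.eq_empty_or_nonempty with rfl | hGne
  · simpa using hP.sum_faceSign hPne
  have hne : ∀ F, G ⊆ p F → F.Nonempty := by
    intro F hF
    by_contra h
    rw [Set.not_nonempty_iff_eq_empty.1 h, hp0] at hF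
    exact hGne.not_subset_empty hF
  have hsplit : hP.finite_faces.toFinset.filter (fun F => G ⊆ p F) =
      hP.finite_faces.toFinset.filter (fun F => p F = G) ∪
        hP.finite_faces.toFinset.filter (fun F => G ⊂ p F) := by
    rw [← Finset.filter_or]
    refine Finset.filter_congr fun F _ => ?_
    rw [subset_iff_ssubset_or_eq, or_comm, eq_comm]
  have hdisj : Disjoint (hP.finite_faces.toFinset.filter (fun F => p F = G))
      (hP.finite_faces.toFinset.filter (fun F => G ⊂ p F)) :=
    Finset.disjoint_filter.2 fun F _ h h' => h'.ne h.symm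
  have h1 := hP.openEuler_eq_sum_openNormalCone (hQ.isRelOpen_openNormalCone hGne)
    (hP.finite_faces.toFinset.filter (fun F => p F = G))
    (fun F hF => hne F (Finset.mem_filter.1 hF).2.ge)
    (fun l => by simp [toExposed_mem_faces, hp, openNormalCone])
  have h2 := hP.sum_openEuler_boundary hQ hp hPne hG hGne hGQ
    (hP.finite_faces.toFinset.filter (fun F => G ⊂ p F)) (fun F => by
      rw [Finset.mem_filter, Set.Finite.mem_toFinset]
      exact and_congr_right fun _ => ⟨fun h => ⟨hne F h.1, h⟩, fun h => h.2⟩)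
  rw [hQ.openEuler_openNormalCone hG hGne] at h1
  have h3 : ∑ F ∈ hP.finite_faces.toFinset with G ⊆ p F,
      openEuler (openNormalCone P F) = 0 := by
    rw [hsplit, Finset.sum_union hdisj, ← h1, h2, add_neg_cancel]
  have hterm : ∀ F ∈ hP.finite_faces.toFinset.filter (fun F => G ⊆ p F),
      openEuler (openNormalCone P F) = (-1) ^ Module.finrank ℝ E * faceSign F := by
    intro F hF
    rw [Finset.mem_filter, Set.Finite.mem_toFinset] at hF
    rw [hP.openEuler_openNormalCone hF.1 (hne F hF.2), neg_one_pow_finrank_constOn,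
      faceSign_of_nonempty (hne F hF.2)]
  rw [Finset.sum_congr rfl hterm, ← Finset.mul_sum] at h3
  exact (mul_eq_zero.1 h3).resolve_left (pow_ne_zero _ (by norm_num))

/-- The alternating sum of the numbers of `k`-dimensional faces of the parts in `Q` of the faces
of `P`. -/
theorem IsPolytope.sum_faceSign_mul_fVec [FiniteDimensional ℝ E] {P Q : Set E} (hP : IsPolytope P)
    (hQ : IsPolytope Q) {p : Set E → Set E} (hp0 : p ∅ = ∅) (hp : ∀ l : StrongDual ℝ E,
      p (l.toExposed P) = l.toExposed Q) (hPne : P.Nonempty) {k : ℤ} (hk : k < dim Q) :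
    ∑ F ∈ hP.finite_faces.toFinset, faceSign F * (fVec k (p F) : ℤ) = 0 := by
  classical
  have hcount : ∀ F ∈ hP.finite_faces.toFinset, (fVec k (p F) : ℤ) =
      ∑ G ∈ hQ.finite_faces.toFinset with dim G = k, if G ⊆ p F then 1 else 0 := by
    intro F hF
    rw [Set.Finite.mem_toFinset] at hF
    have hpF : p F ∈ faces Q := by
      rcases F.eq_empty_or_nonempty with rfl | hne
      · rw [hp0]
        exact isExposed_empty
      · obtain ⟨l, rfl⟩ := exists_toExposed_eq hF hne
        rw [hp]
        exact toExposed_mem_faces Q l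
    rw [fVec, hQ.faces_face hpF, Finset.sum_boole, ← Set.ncard_coe_finset]
    congr 2
    ext G
    simp only [Set.mem_ofPred_eq, Finset.coe_filter, Finset.mem_filter, Set.Finite.mem_toFinset]
    tauto
  -- Double counting: for each k-face G of Q, the inner sum runs over the faces F whose part
  -- contains G.
  rw [Finset.sum_congr rfl fun F hF => by rw [hcount F hF, Finset.mul_sum], Finset.sum_comm]
  refine Finset.sum_eq_zero fun G hG => ?_
  rw [Finset.mem_filter, Set.Finite.mem_toFinset] at hG
  simp only [mul_ite, mul_one, mul_zero]
  rw [← Finset.sum_filter]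
  exact hP.sum_faceSign_filter hQ hp0 hp hPne hG.1 (by rintro rfl; omega)

/-- The sum may have dimension larger than d; this bound transfers k < d to the term Q = P. -/
theorem dim_le_dim_sum [FiniteDimensional ℝ E] {r : ℕ} {P : Fin r → Set E}
    (hne : ∀ i, (P i).Nonempty) (i : Fin r) : dim (P i) ≤ dim (∑ j, P j) := by
  choose z hz using hne
  have hsum : (∑ j, P j).Nonempty := ⟨_, mem_sum_iff.2 ⟨z, hz, rfl⟩⟩
  rw [dim_of_nonempty ⟨z i, hz i⟩, dim_of_nonempty hsum, Nat.cast_le]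
  refine Submodule.finrank_mono ?_
  rw [vectorSpan_def, Submodule.span_le]
  rintro _ ⟨x, hx, y, hy, rfl⟩
  have upd : ∀ w ∈ P i, ∑ j, Function.update z i w j ∈ ∑ j, P j := by
    intro w hw
    refine mem_sum_iff.2 ⟨_, fun j => ?_, rfl⟩
    rcases eq_or_ne j i with rfl | h
    · simpa using hw
    · simpa [h] using hz j
  have := vsub_mem_vectorSpan ℝ (upd x hx) (upd y hy)
  rw [Finset.sum_update_of_mem (Finset.mem_univ i), Finset.sum_update_of_mem (Finset.mem_univ i)]
    at this
  simpa using this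

theorem sum_faceSign_mul_fDelta [FiniteDimensional ℝ E] {r : ℕ} (hr : 0 < r) {P : Fin r → Set E}
    (hP : ∀ i, IsPolytope (P i)) (hne : ∀ i, (P i).Nonempty) {k : ℤ} (hk : ∀ i, k < dim (P i)) :
    ∑ F ∈ (IsPolytope.sum hP).finite_faces.toFinset, faceSign F * fDelta P k F = 0 := by
  have hsum : (∑ i, P i).Nonempty := by
    choose z hz using hne
    exact ⟨_, mem_sum_iff.2 ⟨z, hz, rfl⟩⟩
  have h1 := (IsPolytope.sum hP).sum_faceSign_mul_fVec (IsPolytope.sum hP) (p := id) rfl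
    (fun _ => rfl) hsum ((hk ⟨0, hr⟩).trans_le (dim_le_dim_sum hne _))
  have h2 : ∀ i, ∑ F ∈ (IsPolytope.sum hP).finite_faces.toFinset,
      faceSign F * (fVec k (part P F i) : ℤ) = 0 := fun i =>
    (IsPolytope.sum hP).sum_faceSign_mul_fVec (hP i) (p := fun F => part P F i)
      (by simp [part])
      (fun l => part_eq ((IsPolytope.sum hP).toExposed_nonempty hsum l) l rfl i) hsum (hk i)
  simp only [fDelta, mul_sub, Finset.sum_sub_distrib, Finset.mul_sum]
  rw [Finset.sum_comm, Finset.sum_eq_zero fun i _ => h2 i, sub_zero]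
  exact h1

end AlternatingSums

end MinkowskiFaces

theorem theorem6 {E : Type*} [NormedAddCommGroup E] [NormedSpace ℝ E] [FiniteDimensional ℝ E]
    {r d : ℕ} (hr : 0 < r) (P : Fin r → Set E)
    (hP : ∀ i, MinkowskiFaces.IsPolytope (P i))
    (hd : ∀ i, MinkowskiFaces.dim (P i) = d)
    (k : ℤ) (hk : k < d) :
    (∑ᶠ F ∈ MinkowskiFaces.faces (∑ i, P i),
        (((-1 : ℤˣ) ^ ((d : ℤ) - MinkowskiFaces.dim F) : ℤˣ) : ℤ) *
          MinkowskiFaces.fDelta P k F = 0) ∧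
    (MinkowskiFaces.dim (∑ i, P i) = d →
      MinkowskiFaces.fDelta P k (∑ i, P i) =
        -∑ᶠ F ∈ MinkowskiFaces.faces (∑ i, P i) \ {∑ i, P i},
          (((-1 : ℤˣ) ^ ((d : ℤ) - MinkowskiFaces.dim F) : ℤˣ) : ℤ) *
            MinkowskiFaces.fDelta P k F) := by
  have hne : ∀ i, (P i).Nonempty := by
    intro i
    by_contra h
    have := hd i
    rw [Set.not_nonempty_iff_eq_empty.1 h] at this
    simp only [MinkowskiFaces.dim, if_true] at this
    omega
  have hfin := (MinkowskiFaces.IsPolytope.sum hP).finite_faces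
  have hmain : ∑ᶠ F ∈ MinkowskiFaces.faces (∑ i, P i),
      (((-1 : ℤˣ) ^ ((d : ℤ) - MinkowskiFaces.dim F) : ℤˣ) : ℤ) *
        MinkowskiFaces.fDelta P k F = 0 := by
    rw [finsum_mem_eq_finite_toFinset_sum _ hfin]
    have hterm : ∀ F ∈ hfin.toFinset,
        (((-1 : ℤˣ) ^ ((d : ℤ) - MinkowskiFaces.dim F) : ℤˣ) : ℤ) * MinkowskiFaces.fDelta P k F =
          (-1) ^ d * (MinkowskiFaces.faceSign F * MinkowskiFaces.fDelta P k F) := by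
      intro F _
      -- Units of ℤ are their own inverses, so (-1)^(d - dim F) is (-1)^d times the face sign.
      rw [zpow_sub, zpow_natCast, MinkowskiFaces.faceSign, ← mul_assoc, Int.units_inv_eq_self]
      push_cast
      rfl
    rw [Finset.sum_congr rfl hterm, ← Finset.mul_sum,
      MinkowskiFaces.sum_faceSign_mul_fDelta hr hP hne (fun i => (hd i).symm ▸ hk), mul_zero]
  refine ⟨hmain, fun hdim => ?_⟩
  have hmem : (∑ i, P i) ∈ MinkowskiFaces.faces (∑ i, P i) := IsExposed.refl _
  rw [← Set.insert_sdiff_self_of_mem hmem, finsum_mem_insert _ (by simp) hfin.sdiff, hdim, sub_self,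
    zpow_zero, Units.val_one, one_mul] at hmain
  exact eq_neg_of_add_eq_zero_left hmain
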